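/- Let $G=(V,E,w)$ be a finite simple bipartite graph with positive edge weights $w_{ij}$. Put $W=\sum_{ij\in E}w_{ij}$ and let $M$ be the maximum total weight of a matching of $G$ (a set of edges no two of which share a vertex). Place one qubit on each vertex, and let $X_i,Y_i,Z_i$ be the Pauli matrices acting on qubit $i$ (and as the identity on all other qubits). Define the Hermitian operators on $(\mathbb{C}^2)^{\otimes V}$ $$H^{QMC}=\sum_{ij\in E}\frac{w_{ij}}{2}\,(I-X_iX_j-Y_iY_j-Z_iZ_j),\qquad H^{EPR}=\sum_{ij\in E}\frac{w_{ij}}{2}\,(I+X_iX_j-Y_iY_j+Z_iZ_j),$$ $$H^{XY}=\sum_{ij\in E}\frac{w_{ij}}{2}\,(I-X_iX_j-Y_iY_j),\qquad H^{AFHM}=\sum_{ij\in E}\frac{w_{ij}}{2}\,(X_iX_j+Y_iY_j+Z_iZ_j).$$ Writing $\lambda_{\max}$ and $\lambda_{\min}$ for the largest and smallest eigenvalue, we have $$\lambda_{\max}(H^{QMC})\le W+M,\qquad \lambda_{\max}(H^{EPR})\le W+M,$$ $$\lambda_{\max}(H^{XY})\le W+\frac{M}{2},\qquad \lambda_{\min}(H^{XY})\ge-\frac{M}{2}.$$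 In particular, the ground energy of the antiferromagnetic Heisenberg Hamiltonian satisfies $\lambda_{\min}(H^{AFHM})\ge-\frac{W}{2}-M$. -/

import Mathlib

open scoped Kronecker

noncomputable section

/-! ### Weighted graphs: total weight and maximum weight matching -/

/-- The total edge weight `W(G)`. -/
def totalWeight {V : Type*} [Fintype V] [DecidableEq V]
    (G : SimpleGraph V) [DecidableRel G.Adj] (w : Sym2 V → ℝ) : ℝ :=
  ∑ e ∈ G.edgeFinset, w e

/-- The matchings of `G`: the sets of edges of `G` in which every vertex lies on at most one
edge. -/
def matchings {V : Type*} [Fintype V] [DecidableEq V]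
    (G : SimpleGraph V) [DecidableRel G.Adj] : Finset (Finset (Sym2 V)) :=
  G.edgeFinset.powerset.filter fun R => ∀ v : V, (R.filter fun e => v ∈ e).card ≤ 1

theorem matchings_nonempty {V : Type*} [Fintype V] [DecidableEq V]
    (G : SimpleGraph V) [DecidableRel G.Adj] : (matchings G).Nonempty :=
  ⟨∅, by simp [matchings]⟩

/-- `M(G)`, the maximum total weight of a matching of `G`. -/
def maxMatchingWeight {V : Type*} [Fintype V] [DecidableEq V]
    (G : SimpleGraph V) [DecidableRel G.Adj] (w : Sym2 V → ℝ) : ℝ :=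
  (matchings G).sup' (matchings_nonempty G) fun R => ∑ e ∈ R, w e

/-! ### Extreme eigenvalues of a Hermitian matrix -/

/-- The largest eigenvalue of a Hermitian matrix. -/
def lambdaMax {ι : Type*} [Fintype ι] [DecidableEq ι] [Nonempty ι]
    (A : Matrix ι ι ℂ) (hA : A.IsHermitian) : ℝ :=
  Finset.univ.sup' Finset.univ_nonempty hA.eigenvalues

/-- The smallest eigenvalue of a Hermitian matrix. -/
def lambdaMin {ι : Type*} [Fintype ι] [DecidableEq ι] [Nonempty ι]
    (A : Matrix ι ι ℂ) (hA : A.IsHermitian) : ℝ :=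
  Finset.univ.inf' Finset.univ_nonempty hA.eigenvalues

/-! ### Pauli matrices and two-qubit terms -/

/-- The Pauli matrix `X`. -/
def pauliX : Matrix (Fin 2) (Fin 2) ℂ := !![0, 1; 1, 0]

/-- The Pauli matrix `Y`. -/
def pauliY : Matrix (Fin 2) (Fin 2) ℂ := !![0, -Complex.I; Complex.I, 0]

/-- The Pauli matrix `Z`. -/
def pauliZ : Matrix (Fin 2) (Fin 2) ℂ := !![1, 0; 0, -1]

/-- A two-qubit Hamiltonian term: a Hermitian `4 × 4` matrix that is invariant under exchanging
the two qubits, so that it can be applied to an unordered pair of qubits. -/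
structure TwoQubitTerm where
  mat : Matrix (Fin 2 × Fin 2) (Fin 2 × Fin 2) ℂ
  isHermitian : mat.IsHermitian
  swap : ∀ a b : Fin 2 × Fin 2, mat a.swap b.swap = mat a b

/-- `(I ⊗ I - X ⊗ X - Y ⊗ Y - Z ⊗ Z) / 2`, the Quantum MaxCut term. -/
def termQMC : TwoQubitTerm where
  mat := (1 / 2 : ℂ) • ((1 : Matrix (Fin 2) (Fin 2) ℂ) ⊗ₖ (1 : Matrix (Fin 2) (Fin 2) ℂ)
    - pauliX ⊗ₖ pauliX - pauliY ⊗ₖ pauliY - pauliZ ⊗ₖ pauliZ)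
  isHermitian := by
    ext ⟨a, b⟩ ⟨c, d⟩
    fin_cases a <;> fin_cases b <;> fin_cases c <;> fin_cases d <;>
      norm_num [Matrix.conjTranspose_apply, pauliX, pauliY, pauliZ]
  swap := by
    rintro ⟨a, b⟩ ⟨c, d⟩
    simp [Matrix.kroneckerMap_apply, Matrix.one_apply, and_comm, mul_comm]

/-- `(I ⊗ I + X ⊗ X - Y ⊗ Y + Z ⊗ Z) / 2`, the EPR term. -/
def termEPR : TwoQubitTerm where
  mat := (1 / 2 : ℂ) • ((1 : Matrix (Fin 2) (Fin 2) ℂ) ⊗ₖ (1 : Matrix (Fin 2) (Fin 2) ℂ)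
    + pauliX ⊗ₖ pauliX - pauliY ⊗ₖ pauliY + pauliZ ⊗ₖ pauliZ)
  isHermitian := by
    ext ⟨a, b⟩ ⟨c, d⟩
    fin_cases a <;> fin_cases b <;> fin_cases c <;> fin_cases d <;>
      norm_num [Matrix.conjTranspose_apply, pauliX, pauliY, pauliZ]
  swap := by
    rintro ⟨a, b⟩ ⟨c, d⟩
    simp [Matrix.kroneckerMap_apply, Matrix.one_apply, and_comm, mul_comm]

/-- `(I ⊗ I - X ⊗ X - Y ⊗ Y) / 2`, the XY term. -/
def termXY : TwoQubitTerm where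
  mat := (1 / 2 : ℂ) • ((1 : Matrix (Fin 2) (Fin 2) ℂ) ⊗ₖ (1 : Matrix (Fin 2) (Fin 2) ℂ)
    - pauliX ⊗ₖ pauliX - pauliY ⊗ₖ pauliY)
  isHermitian := by
    ext ⟨a, b⟩ ⟨c, d⟩
    fin_cases a <;> fin_cases b <;> fin_cases c <;> fin_cases d <;>
      norm_num [Matrix.conjTranspose_apply, pauliX, pauliY]
  swap := by
    rintro ⟨a, b⟩ ⟨c, d⟩
    simp [Matrix.kroneckerMap_apply, Matrix.one_apply, and_comm, mul_comm]

/-- `(X ⊗ X + Y ⊗ Y + Z ⊗ Z) / 2`, the antiferromagnetic Heisenberg term. -/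
def termAFHM : TwoQubitTerm where
  mat := (1 / 2 : ℂ) • (pauliX ⊗ₖ pauliX + pauliY ⊗ₖ pauliY + pauliZ ⊗ₖ pauliZ)
  isHermitian := by
    ext ⟨a, b⟩ ⟨c, d⟩
    fin_cases a <;> fin_cases b <;> fin_cases c <;> fin_cases d <;>
      norm_num [Matrix.conjTranspose_apply, pauliX, pauliY, pauliZ]
  swap := by
    rintro ⟨a, b⟩ ⟨c, d⟩
    simp [Matrix.kroneckerMap_apply, Matrix.one_apply, and_comm, mul_comm]

/-! ### Two-local Hamiltonians on a weighted graph

The qubits are the vertices; the Hilbert space `(ℂ²)^{⊗ V}` has the computational basis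
`V → Fin 2`, so that operators are matrices indexed by `V → Fin 2`. -/

/-- The term `h` applied to the qubits `i` and `j`, tensored with the identity on all other
qubits (for `i ≠ j`). -/
def pairOp {V : Type*} [Fintype V] [DecidableEq V] (h : TwoQubitTerm) (i j : V) :
    Matrix (V → Fin 2) (V → Fin 2) ℂ :=
  Matrix.of fun x y =>
    if ∀ k : V, k ≠ i → k ≠ j → x k = y k then h.mat (x i, x j) (y i, y j) else 0

theorem pairOp_comm {V : Type*} [Fintype V] [DecidableEq V] (h : TwoQubitTerm) (i j : V) :
    pairOp h i j = pairOp h j i := by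
  ext x y
  have h1 : (∀ k : V, k ≠ i → k ≠ j → x k = y k) ↔ (∀ k : V, k ≠ j → k ≠ i → x k = y k) :=
    ⟨fun H k a b => H k b a, fun H k a b => H k b a⟩
  have h2 : h.mat (x i, x j) (y i, y j) = h.mat (x j, x i) (y j, y i) :=
    h.swap (x j, x i) (y j, y i)
  simp only [pairOp, Matrix.of_apply, h1, h2]

theorem pairOp_isHermitian {V : Type*} [Fintype V] [DecidableEq V] (h : TwoQubitTerm)
    (i j : V) : (pairOp h i j).IsHermitian := by
  ext x y
  have h1 : (∀ k : V, k ≠ i → k ≠ j → x k = y k) ↔ (∀ k : V, k ≠ i → k ≠ j → y k = x k) :=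
    ⟨fun H k a b => (H k a b).symm, fun H k a b => (H k a b).symm⟩
  have h2 : star (h.mat (y i, y j) (x i, x j)) = h.mat (x i, x j) (y i, y j) :=
    h.isHermitian.apply _ _
  simp only [pairOp, Matrix.conjTranspose_apply, Matrix.of_apply, h1]
  split_ifs
  · exact h2
  · exact star_zero _

/-- The term `h` applied to the two endpoints of an edge. -/
def edgeOp {V : Type*} [Fintype V] [DecidableEq V] (h : TwoQubitTerm) (e : Sym2 V) :
    Matrix (V → Fin 2) (V → Fin 2) ℂ :=
  Sym2.lift ⟨fun i j => pairOp h i j, fun i j => pairOp_comm h i j⟩ e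

/-- The Hamiltonian `H(G) = ∑_{ij ∈ E} w_{ij} h_{ij}`. -/
def hamiltonian {V : Type*} [Fintype V] [DecidableEq V] (h : TwoQubitTerm)
    (G : SimpleGraph V) [DecidableRel G.Adj] (w : Sym2 V → ℝ) :
    Matrix (V → Fin 2) (V → Fin 2) ℂ :=
  ∑ e ∈ G.edgeFinset, (w e : ℂ) • edgeOp h e

theorem hamiltonian_isHermitian {V : Type*} [Fintype V] [DecidableEq V] (h : TwoQubitTerm)
    (G : SimpleGraph V) [DecidableRel G.Adj] (w : Sym2 V → ℝ) :
    (hamiltonian h G w).IsHermitian := by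
  have key : ∀ e : Sym2 V, (edgeOp h e).conjTranspose = edgeOp h e := by
    intro e
    induction e using Sym2.ind with
    | _ i j => exact pairOp_isHermitian h i j
  simp [Matrix.IsHermitian, hamiltonian, Matrix.conjTranspose_sum, key]

end

/-! The Quantum MaxCut term is `1 - P_{ij}`, where `P_{ij}` swaps qubits `i` and `j`, so the first
bound says `∑ w_{ij} P_{ij} ≥ -M` in the positive semidefinite order.

On a star with centre `o`, swaps with weights in `[0, y]` sum to at least `-y` (`star_posSemidef`).
To reduce to stars, Egerváry's theorem (`exists_vertexCover_le_maxMatchingWeight`) gives `u, v ≥ 0`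
with `w_{ij} ≤ u_i + v_j` on oriented edges and `∑ u + ∑ v ≤ M`. Each weight splits as `min(w_{ij},
u_i)`, charged to the star at `i`, plus a remainder at most `v_j`, charged to the star at `j`; the
star bounds add up to `-(∑ u + ∑ v) ≥ -M`.

The other Hamiltonians reduce to `H = H^{QMC}`. Conjugation by `Y` on one colour class turns `H`
into `H^{EPR}`. With `Z` acting on that class, `H^{XY} = (H + Z (W - H) Z) / 2`, and both XY bounds
follow from `0 ≤ H ≤ W + M`. Finally `H^{AFHM} = W/2 - H`. -/

/-- The permutation operator of `σ` on the qubits `V`. -/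
def qubitPerm {V : Type*} [Fintype V] [DecidableEq V] (σ : Equiv.Perm V) :
    Matrix (V → Fin 2) (V → Fin 2) ℂ :=
  Matrix.of fun x y => Pi.single (M := fun _ => ℂ) (x ∘ σ) 1 y

/-! ### Swap operators and the star bound. -/

section QubitPerm

open scoped ComplexOrder

theorem comp_swap_of_eq {V : Type*} [DecidableEq V] {x : V → Fin 2} {i j : V} (h : x i = x j) :
    x ∘ Equiv.swap i j = x := by
  funext k
  simp only [Function.comp_apply, Equiv.swap_apply_def]
  split_ifs with h1 h2
  · rw [h1, h]
  · rw [h2, h]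
  · rfl

/-- Expanding the square symmetrically, the formula for `A i * A j + A j * A i` fails on the
diagonal only, where it is short by `2 (1 - A i)`. The double sum on the right is kept explicit
because it is positive semidefinite when the `B i j` are swaps. -/
theorem sum_mul_sum_self_of_anticommutator {R ι : Type*} [Ring R] [Algebra ℝ R] [DecidableEq ι]
    (S : Finset ι) (A : ι → R) (B : ι → ι → R) (hA : ∀ i ∈ S, A i * A i = 1)
    (hB : ∀ i ∈ S, B i i = 1)
    (hAB : ∀ i ∈ S, ∀ j ∈ S, i ≠ j → A i * A j + A j * A i = A i + A j + B i j - 1) :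
    (2 : ℝ) • ((∑ i ∈ S, A i) * ∑ i ∈ S, A i) = (2 * S.card - 2 : ℝ) • ∑ i ∈ S, A i
      + (2 * S.card : ℝ) • 1 - ∑ i ∈ S, ∑ j ∈ S, (1 - B i j) := by
  have h1 : (2 : ℝ) • ((∑ i ∈ S, A i) * ∑ i ∈ S, A i)
      = ∑ i ∈ S, ∑ j ∈ S, (A i * A j + A j * A i) := by
    simp only [Finset.sum_add_distrib]
    rw [two_smul, Finset.sum_mul_sum]
    congr 1
    rw [Finset.sum_comm]
  have h2 : ∀ i ∈ S, ∀ j ∈ S, A i * A j + A j * A i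
      = A i + A j - (1 - B i j) + if i = j then (2 : ℝ) • (1 - A i) else 0 := by
    intro i hi j hj
    split_ifs with hij
    · subst hij
      rw [hA i hi, hB i hi]
      module
    · rw [hAB i hi j hj hij]
      abel
  rw [h1, Finset.sum_congr rfl fun i hi => Finset.sum_congr rfl (h2 i hi)]
  simp only [Finset.sum_add_distrib, Finset.sum_sub_distrib, Finset.sum_const,
    Finset.sum_ite_eq, Finset.sum_ite_mem, Finset.inter_self, ← Finset.smul_sum,
    ← Nat.cast_smul_eq_nsmul ℝ]
  module

variable {V : Type*} [Fintype V] [DecidableEq V]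

theorem qubitPerm_apply (σ : Equiv.Perm V) (x y : V → Fin 2) :
    qubitPerm σ x y = Pi.single (M := fun _ => ℂ) (x ∘ σ) 1 y :=
  rfl

theorem qubitPerm_one : qubitPerm (1 : Equiv.Perm V) = 1 := by
  ext x y
  simp [qubitPerm_apply, Matrix.one_apply, Pi.single_apply, eq_comm]

theorem qubitPerm_mul (σ τ : Equiv.Perm V) :
    qubitPerm (σ * τ) = qubitPerm σ * qubitPerm τ := by
  ext x y
  simp only [qubitPerm_apply, Matrix.mul_apply, Equiv.Perm.coe_mul,
    ← Function.comp_assoc]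
  simp [Pi.single_apply (x ∘ σ)]

theorem conjTranspose_qubitPerm (σ : Equiv.Perm V) :
    (qubitPerm σ).conjTranspose = qubitPerm σ⁻¹ := by
  ext x y
  have h : x = y ∘ σ ↔ y = x ∘ ⇑σ⁻¹ := by
    constructor
    · rintro rfl; funext k; simp
    · rintro rfl; funext k; simp
  simp only [qubitPerm_apply, Matrix.conjTranspose_apply, Pi.single_apply, h]
  split_ifs <;> simp

theorem qubitPerm_swap_sq (i j : V) :
    qubitPerm (Equiv.swap i j) * qubitPerm (Equiv.swap i j) = 1 := by
  rw [← qubitPerm_mul, Equiv.swap_mul_self, qubitPerm_one]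

theorem qubitPerm_swap_isHermitian (i j : V) :
    (qubitPerm (Equiv.swap i j)).IsHermitian := by
  rw [Matrix.IsHermitian, conjTranspose_qubitPerm, Equiv.swap_inv]

/-- The antisymmetrizer of three qubits vanishes. -/
theorem qubitPerm_anticommutator {o i j : V} (hi : i ≠ o) (hj : j ≠ o) (hij : i ≠ j) :
    qubitPerm (Equiv.swap o i) * qubitPerm (Equiv.swap o j)
      + qubitPerm (Equiv.swap o j) * qubitPerm (Equiv.swap o i)
      = qubitPerm (Equiv.swap o i) + qubitPerm (Equiv.swap o j)
        + qubitPerm (Equiv.swap i j) - 1 := by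
  have e1 : Equiv.swap o i * Equiv.swap o j * Equiv.swap o i = Equiv.swap i j := by
    have := Equiv.swap_mul_swap_mul_swap (x := j) (y := o) (z := i) hj hij.symm
    rw [Equiv.swap_comm j o, Equiv.swap_comm o i] at *
    grind
  have e2 : Equiv.swap o j * Equiv.swap o i * Equiv.swap o j = Equiv.swap i j := by
    have := Equiv.swap_mul_swap_mul_swap (x := i) (y := o) (z := j) hi hij
    grind [Equiv.swap_comm]
  have c1 : ∀ x : V → Fin 2, ((x ∘ Equiv.swap o i) ∘ Equiv.swap o j) ∘ Equiv.swap o i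
      = x ∘ Equiv.swap i j := fun x => by rw [← e1]; rfl
  have c2 : ∀ x : V → Fin 2, ((x ∘ Equiv.swap o j) ∘ Equiv.swap o i) ∘ Equiv.swap o j
      = x ∘ Equiv.swap i j := fun x => by rw [← e2]; rfl
  rw [← qubitPerm_mul, ← qubitPerm_mul, ← qubitPerm_one]
  ext x y
  simp only [qubitPerm_apply, Matrix.add_apply, Matrix.sub_apply,
    Equiv.Perm.coe_mul, ← Function.comp_assoc, Equiv.Perm.coe_one, Function.comp_id]
  -- Two of three bits agree, so one of the three transpositions fixes `x`; the six permuted strings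
  -- then cancel in pairs.
  have hx : x o = x i ∨ x o = x j ∨ x i = x j := by omega
  rcases hx with h | h | h
  · have h1 := comp_swap_of_eq h
    have h2 := c1 x
    rw [h1] at h2
    simp only [h1, h2]; ring
  · have h1 := comp_swap_of_eq h
    have h2 := c2 x
    rw [h1] at h2
    simp only [h1, h2]; ring
  · have h1 := comp_swap_of_eq h
    have h2 := c1 x
    have h3 := c2 x
    rw [h1] at h2 h3
    have h4 : (x ∘ Equiv.swap o i) ∘ Equiv.swap o j = x ∘ Equiv.swap o i := by
      conv_rhs => rw [← h2]
      funext k; simp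
    have h5 : (x ∘ Equiv.swap o j) ∘ Equiv.swap o i = x ∘ Equiv.swap o j := by
      conv_rhs => rw [← h3]
      funext k; simp
    simp only [h1, h4, h5]; ring

theorem one_sub_qubitPerm_swap_posSemidef (i j : V) :
    (1 - qubitPerm (Equiv.swap i j)).PosSemidef := by
  have h : 1 - qubitPerm (Equiv.swap i j) = (1 / 2 : ℝ) •
      ((1 - qubitPerm (Equiv.swap i j)).conjTranspose * (1 - qubitPerm (Equiv.swap i j))) := by
    rw [Matrix.conjTranspose_sub, Matrix.conjTranspose_one,
      (qubitPerm_swap_isHermitian i j).eq, sub_mul, mul_sub, mul_sub, qubitPerm_swap_sq,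
      one_mul, one_mul, mul_one]
    module
  rw [h]
  exact (Matrix.posSemidef_conjTranspose_mul_self _).smul (by norm_num)

/-- The anticommutator relation makes `(|S| + 1)(1 + J)` equal to `(1 + J)²` plus half the sum of
the operators `1 - P_{ij}` over pairs of leaves, which are all positive semidefinite. -/
theorem one_add_sum_qubitPerm_swap_posSemidef {o : V} {S : Finset V} (ho : o ∉ S) :
    (1 + ∑ i ∈ S, qubitPerm (Equiv.swap o i)).PosSemidef := by
  set J := ∑ i ∈ S, qubitPerm (Equiv.swap o i) with hJ
  have hne : ∀ i ∈ S, i ≠ o := fun i hi h => ho (h ▸ hi)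
  have hJH : J.conjTranspose = J := by
    simp only [hJ, Matrix.conjTranspose_sum, (qubitPerm_swap_isHermitian _ _).eq]
  have hsq : (2 : ℝ) • (J * J) = ((2 * S.card - 2 : ℝ)) • J + (2 * S.card : ℝ) • 1
      - ∑ i ∈ S, ∑ j ∈ S, (1 - qubitPerm (Equiv.swap i j)) := by
    refine sum_mul_sum_self_of_anticommutator S _ (fun i j => qubitPerm (Equiv.swap i j))
      (fun i _ => qubitPerm_swap_sq o i) (fun i _ => ?_)
      fun i hi j hj hij => qubitPerm_anticommutator (hne i hi) (hne j hj) hij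
    simp only [Equiv.swap_self, ← Equiv.Perm.one_def, qubitPerm_one]
  have hmain : 1 + J = (1 / (S.card + 1) : ℝ) • ((1 + J).conjTranspose * (1 + J)
      + (1 / 2 : ℝ) • ∑ i ∈ S, ∑ j ∈ S, (1 - qubitPerm (Equiv.swap i j))) := by
    have h0 : (S.card + 1 : ℝ) ≠ 0 := by positivity
    have h3 : (∑ i ∈ S, ∑ j ∈ S, (1 - qubitPerm (Equiv.swap i j)))
        = ((2 * S.card - 2 : ℝ)) • J + (2 * S.card : ℝ) • 1 - (2 : ℝ) • (J * J) := by
      rw [hsq]; abel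
    rw [eq_comm, one_div, inv_smul_eq_iff₀ h0, h3, Matrix.conjTranspose_add, hJH,
      Matrix.conjTranspose_one, add_mul, mul_add, mul_add, one_mul, one_mul, mul_one]
    module
  rw [hmain]
  refine Matrix.PosSemidef.smul (Matrix.PosSemidef.add
    (Matrix.posSemidef_conjTranspose_mul_self _) (Matrix.PosSemidef.smul ?_ (by norm_num)))
    (by positivity)
  exact Matrix.posSemidef_sum _ fun i _ => Matrix.posSemidef_sum _ fun j _ =>
    one_sub_qubitPerm_swap_posSemidef i j

/-- The operator is affine in each `t i`, hence a convex combination of its values at `t i = 0` and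
`t i = 1`. The set `R` collects the leaves whose weight has been set to 1, and must be general for
the induction. -/
theorem one_add_sum_smul_qubitPerm_swap_posSemidef {o : V} (t : V → ℝ) (S : Finset V)
    (ho : o ∉ S) (h0 : ∀ i ∈ S, 0 ≤ t i) (h1 : ∀ i ∈ S, t i ≤ 1) (R : Finset V) (hR : o ∉ R)
    (hRS : Disjoint R S) :
    (1 + ∑ i ∈ R, qubitPerm (Equiv.swap o i)
      + ∑ i ∈ S, t i • qubitPerm (Equiv.swap o i)).PosSemidef := by
  induction S using Finset.induction_on generalizing R with
  | empty => simpa using one_add_sum_qubitPerm_swap_posSemidef hR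
  | insert i S hi ih =>
    simp only [Finset.mem_insert, forall_eq_or_imp, not_or, Finset.disjoint_insert_right] at *
    have ha := ih ho.2 h0.2 h1.2 R hR hRS.2
    have hb := ih ho.2 h0.2 h1.2 (insert i R) (by simp [ho.1, hR])
      (by simp [hi, hRS.2])
    have key : 1 + ∑ i ∈ R, qubitPerm (Equiv.swap o i)
        + ∑ i ∈ insert i S, t i • qubitPerm (Equiv.swap o i)
        = (1 - t i) • (1 + ∑ i ∈ R, qubitPerm (Equiv.swap o i)
            + ∑ i ∈ S, t i • qubitPerm (Equiv.swap o i))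
          + t i • (1 + ∑ i ∈ insert i R, qubitPerm (Equiv.swap o i)
            + ∑ i ∈ S, t i • qubitPerm (Equiv.swap o i)) := by
      rw [Finset.sum_insert hi, Finset.sum_insert hRS.1]
      module
    rw [key]
    exact (ha.smul (by linarith [h1.1])).add (hb.smul h0.1)

/-- The star bound: swap operators with weights in `[0, y]` on a star sum to at least `-y`. -/
theorem star_posSemidef {o : V} (y : ℝ) (a : V → ℝ) (h0 : ∀ i, 0 ≤ a i) (hy : ∀ i, a i ≤ y)
    (ho : a o = 0) :
    (y • 1 + ∑ i, a i • qubitPerm (Equiv.swap o i)).PosSemidef := by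
  -- The weights are rescaled by `y`, so `y = 0` is treated apart.
  rcases ((h0 o).trans (hy o)).eq_or_lt with hy0 | hy0
  · have : ∀ i, a i = 0 := fun i => le_antisymm (hy0 ▸ hy i) (h0 i)
    simp [← hy0, this, Matrix.PosSemidef.zero]
  · have h := (one_add_sum_smul_qubitPerm_swap_posSemidef (o := o) (fun i => a i / y)
      (Finset.univ.erase o) (by simp) (fun i _ => div_nonneg (h0 i) hy0.le)
      (fun i _ => (div_le_one hy0).2 (hy i)) ∅ (by simp) (by simp)).smul hy0.le
    convert h using 1
    rw [Finset.sum_empty, add_zero, smul_add, Finset.smul_sum,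
      ← Finset.add_sum_erase _ _ (Finset.mem_univ o), ho, zero_smul, zero_add]
    congr 1
    refine Finset.sum_congr rfl fun i _ => ?_
    rw [smul_smul, mul_div_cancel₀ _ hy0.ne']

end QubitPerm

/-! ### Duality for the assignment problem. -/

section Assignment

variable {ι : Type*} [Fintype ι]

/-- The feasible dual pairs of the assignment problem with weights `w`. -/
def IsDualFeasible (w : ι → ι → ℝ) (p : (ι → ℝ) × (ι → ℝ)) : Prop :=
  ∀ i j, w i j ≤ p.1 i + p.2 j

/-- Both sides have the same number of indices, so moving a constant from `p.1` to `p.2` preserves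
the objective. With the minimum of `p.1` as the constant, feasibility in the minimizing row forces
`p.2` to become nonnegative. -/
theorem exists_nonneg_isDualFeasible [Nonempty ι] {w : ι → ι → ℝ} (hw : ∀ i j, 0 ≤ w i j)
    {p : (ι → ℝ) × (ι → ℝ)} (hp : IsDualFeasible w p) :
    ∃ q, IsDualFeasible w q ∧ 0 ≤ q ∧
      ∑ i, q.1 i + ∑ i, q.2 i = ∑ i, p.1 i + ∑ i, p.2 i := by
  obtain ⟨k, hk⟩ := Finite.exists_min p.1
  refine ⟨(fun i => p.1 i - p.1 k, fun j => p.2 j + p.1 k), fun i j => ?_, ⟨?_, ?_⟩, ?_⟩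
  · have := hp i j
    simp only
    linarith
  · intro i
    simpa using hk i
  · intro j
    have h1 := hp k j
    have h2 := hw k j
    simp only [Prod.snd_zero, Pi.zero_apply]
    linarith
  · simp [Finset.sum_sub_distrib, Finset.sum_add_distrib]

/-- Nonnegative pairs no worse than `p₀` lie in a compact box, so a minimum exists there. By the
shift above it is minimal among all feasible pairs, signed ones included; this permits perturbations
that leave the nonnegative cone. -/
theorem exists_min_isDualFeasible [Nonempty ι] {w : ι → ι → ℝ} (hw : ∀ i j, 0 ≤ w i j) :
    ∃ p, IsDualFeasible w p ∧ 0 ≤ p ∧ ∀ q, IsDualFeasible w q →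
      ∑ i, p.1 i + ∑ i, p.2 i ≤ ∑ i, q.1 i + ∑ i, q.2 i := by
  let f : (ι → ℝ) × (ι → ℝ) → ℝ := fun p => ∑ i, p.1 i + ∑ i, p.2 i
  have hf : Continuous f := by fun_prop
  let p₀ : (ι → ℝ) × (ι → ℝ) := (fun i => ∑ j, w i j, 0)
  have hp₀ : IsDualFeasible w p₀ := fun i j => by
    simpa [p₀] using Finset.single_le_sum (fun k _ => hw i k) (Finset.mem_univ j)
  have hp₀' : 0 ≤ p₀ := ⟨fun i => Finset.sum_nonneg fun j _ => hw i j, le_rfl⟩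
  let b : (ι → ℝ) × (ι → ℝ) := (fun _ => f p₀, fun _ => f p₀)
  have hle : ∀ q : (ι → ℝ) × (ι → ℝ), 0 ≤ q → f q ≤ f p₀ → q ≤ b := by
    rintro q ⟨h1, h2⟩ hq
    have s1 : 0 ≤ ∑ i, q.1 i := Finset.sum_nonneg fun i _ => h1 i
    have s2 : 0 ≤ ∑ i, q.2 i := Finset.sum_nonneg fun i _ => h2 i
    constructor
    · intro i
      have := Finset.single_le_sum (fun k _ => h1 k) (Finset.mem_univ i)
      simp only [f, b, Prod.fst_zero] at *
      linarith
    · intro i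
      have := Finset.single_le_sum (fun k _ => h2 k) (Finset.mem_univ i)
      simp only [f, b, Prod.snd_zero] at *
      linarith
  have hcl : IsClosed {p : (ι → ℝ) × (ι → ℝ) | IsDualFeasible w p} := by
    simp only [IsDualFeasible, Set.ofPred_forall]
    exact isClosed_iInter fun i => isClosed_iInter fun j =>
      isClosed_le continuous_const (by fun_prop)
  obtain ⟨p, ⟨hp1, hp2⟩, hpm⟩ := ((isCompact_Icc (a := 0) (b := b)).inter_right hcl).exists_isMinOn
    ⟨p₀, ⟨hp₀', hle p₀ hp₀' le_rfl⟩, hp₀⟩ hf.continuousOn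
  refine ⟨p, hp2, hp1.1, fun q hq => ?_⟩
  obtain ⟨r, hr, hr0, hrq⟩ := exists_nonneg_isDualFeasible hw hq
  rw [← hrq]
  by_cases h : f r ≤ f p₀
  · exact hpm ⟨⟨hr0, hle r hr0 h⟩, hr⟩
  · exact (hpm ⟨⟨hp₀', hle p₀ hp₀' le_rfl⟩, hp₀⟩ : f p ≤ f p₀).trans (not_le.1 h).le

/-- Linear programming duality for the assignment problem. -/
theorem exists_perm_sum_eq_dual [DecidableEq ι] {w : ι → ι → ℝ} (hw : ∀ i j, 0 ≤ w i j) :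
    ∃ (u v : ι → ℝ) (σ : Equiv.Perm ι), (∀ i, 0 ≤ u i) ∧ (∀ i, 0 ≤ v i) ∧
      (∀ i j, w i j ≤ u i + v j) ∧ ∑ i, u i + ∑ i, v i = ∑ i, w i (σ i) := by
  rcases isEmpty_or_nonempty ι with h | h
  · exact ⟨0, 0, 1, by simp, by simp, by simp, by simp⟩
  obtain ⟨⟨u, v⟩, hf, ⟨hu, hv⟩, hmin⟩ := exists_min_isDualFeasible hw
  let T : ι → Finset ι := fun i => Finset.univ.filter fun j => u i + v j = w i j
  -- Hall's condition for the graph of tight pairs. If `S` violates it, lowering `u` by `ε` on `S`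
  -- and raising `v` by `ε` on its neighbours stays feasible, since only pairs with slack at least
  -- `ε` lose slack, and the objective strictly drops.
  have hall : ∀ S : Finset ι, S.card ≤ (S.biUnion T).card := by
    intro S
    by_contra hS
    obtain ⟨ε, hε0, hε⟩ : ∃ ε : ℝ, 0 < ε ∧ ∀ i j, w i j < u i + v j → ε ≤ u i + v j - w i j := by
      have h1 : ∀ᶠ ε in nhdsWithin (0 : ℝ) (Set.Ioi 0),
          ∀ i j, w i j < u i + v j → ε ≤ u i + v j - w i j := by
        simp only [Filter.eventually_all]
        intro i j hij
        exact nhdsWithin_le_nhds (Iic_mem_nhds (sub_pos.2 hij))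
      obtain ⟨ε, h2, h3⟩ := (h1.and self_mem_nhdsWithin).exists
      exact ⟨ε, h3, h2⟩
    have h1 := hmin (fun i => u i - if i ∈ S then ε else 0,
      fun j => v j + if j ∈ S.biUnion T then ε else 0) (by
        intro i j
        have h2 := hf i j
        simp only at h2 ⊢
        by_cases hi : i ∈ S
        · by_cases hj : j ∈ S.biUnion T
          · simp only [hi, hj, if_true]; linarith
          · have h3 : w i j ≠ u i + v j := fun h => hj (Finset.mem_biUnion.2
              ⟨i, hi, by simp [T, h]⟩)
            have h4 := hε i j (lt_of_le_of_ne h2 h3)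
            simp only [hi, hj, if_true, if_false]; linarith
        · simp only [hi, if_false]
          split_ifs <;> linarith)
    simp only [Finset.sum_sub_distrib, Finset.sum_add_distrib, Finset.sum_ite_mem,
      Finset.univ_inter, Finset.sum_const, nsmul_eq_mul] at h1
    have h2 : ((S.biUnion T).card : ℝ) < S.card := by exact_mod_cast not_le.1 hS
    nlinarith
  obtain ⟨g, hg, hgT⟩ := (Finset.all_card_le_biUnion_card_iff_exists_injective T).1 hall
  refine ⟨u, v, Equiv.ofBijective g (Finite.injective_iff_bijective.1 hg), hu, hv, hf, ?_⟩
  have h2 : ∀ i, w i (g i) = u i + v (g i) := fun i => by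
    have := hgT i
    simp only [T, Finset.mem_filter] at this
    exact this.2.symm
  simp only [Equiv.ofBijective_apply, h2, Finset.sum_add_distrib]
  rw [(Finite.injective_iff_bijective.1 hg).sum_comp v]

end Assignment

/-! ### From semidefinite inequalities to eigenvalue bounds. -/

section ExtremeEigenvalues

open scoped ComplexOrder

variable {ι : Type*} [Fintype ι] [DecidableEq ι]

omit [DecidableEq ι] in
theorem nonneg_of_posSemidef_of_mulVec_eq {A : Matrix ι ι ℂ} (hA : A.PosSemidef) {v : ι → ℂ}
    (hv : v ≠ 0) {r : ℝ} (h : A.mulVec v = r • v) : 0 ≤ r := by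
  have h1 := hA.dotProduct_mulVec_nonneg v
  have h2 : 0 < star v ⬝ᵥ v := Matrix.dotProduct_star_self_pos_iff.2 hv
  rw [h, dotProduct_smul, Complex.real_smul] at h1
  have h3 := (Complex.nonneg_iff.1 h1).1
  rw [Complex.re_ofReal_mul] at h3
  exact nonneg_of_mul_nonneg_left h3 (Complex.pos_iff.1 h2).1

theorem eigenvectorBasis_coe_ne_zero {A : Matrix ι ι ℂ} (hA : A.IsHermitian) (i : ι) :
    (⇑(hA.eigenvectorBasis i) : ι → ℂ) ≠ 0 := fun h =>
  hA.eigenvectorBasis.toBasis.ne_zero i (by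
    rw [OrthonormalBasis.coe_toBasis]
    ext k
    exact congrFun h k)

theorem lambdaMax_le [Nonempty ι] {A : Matrix ι ι ℂ} (hA : A.IsHermitian) {c : ℝ}
    (h : (c • 1 - A).PosSemidef) : lambdaMax A hA ≤ c := by
  refine Finset.sup'_le _ _ fun i _ => ?_
  rw [← sub_nonneg]
  refine nonneg_of_posSemidef_of_mulVec_eq h (eigenvectorBasis_coe_ne_zero hA i) ?_
  rw [Matrix.sub_mulVec, Matrix.smul_mulVec, Matrix.one_mulVec, hA.mulVec_eigenvectorBasis,
    sub_smul]

theorem le_lambdaMin [Nonempty ι] {A : Matrix ι ι ℂ} (hA : A.IsHermitian) {c : ℝ}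
    (h : (A - c • 1).PosSemidef) : c ≤ lambdaMin A hA := by
  refine Finset.le_inf' _ _ fun i _ => ?_
  rw [← sub_nonneg]
  refine nonneg_of_posSemidef_of_mulVec_eq h (eigenvectorBasis_coe_ne_zero hA i) ?_
  rw [Matrix.sub_mulVec, Matrix.smul_mulVec, Matrix.one_mulVec, hA.mulVec_eigenvectorBasis,
    sub_smul]

end ExtremeEigenvalues

/-! ### The two-qubit terms expressed through the swap. -/

section PauliTerms

/-- The diagonal entries of the Pauli matrix `Z`. -/
def bitSign (a : Fin 2) : ℂ := if a = 0 then 1 else -1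

theorem bitSign_mul_self (a : Fin 2) : bitSign a * bitSign a = 1 := by
  unfold bitSign; split_ifs <;> norm_num

theorem termQMC_mat_apply (a b c d : Fin 2) :
    termQMC.mat (a, b) (c, d)
      = (if a = c ∧ b = d then 1 else 0) - (if b = c ∧ a = d then 1 else 0) := by
  fin_cases a <;> fin_cases b <;> fin_cases c <;> fin_cases d <;>
    norm_num [termQMC, pauliX, pauliY, pauliZ]

/-- Conjugation by `Y` on the second qubit reverses the signs of `X ⊗ X` and `Z ⊗ Z` only. Up to a
phase `Y` is a bit flip times `Z`: hence the shifts by 1 and the signs. -/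
theorem termEPR_mat_apply (a b c d : Fin 2) :
    termEPR.mat (a, b) (c, d)
      = bitSign b * bitSign d * termQMC.mat (a, b + 1) (c, d + 1) := by
  have h : (1 + 1 : Fin 2) = 0 := rfl
  rw [termQMC_mat_apply]
  fin_cases a <;> fin_cases b <;> fin_cases c <;> fin_cases d <;>
    norm_num [termEPR, bitSign, h, pauliX, pauliY, pauliZ]

/-- Conjugating the swap `(I + XX + YY + ZZ)/2` by `Z` on one qubit reverses `XX` and `YY` but not
`ZZ`, so averaging with the Quantum MaxCut term cancels `ZZ`. -/
theorem termXY_mat_apply (a b c d : Fin 2) :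
    termXY.mat (a, b) (c, d) = (1 / 2) * termQMC.mat (a, b) (c, d)
      + (1 / 2) * (bitSign b * bitSign d *
        ((if a = c ∧ b = d then 1 else 0) - termQMC.mat (a, b) (c, d))) := by
  rw [termQMC_mat_apply]
  fin_cases a <;> fin_cases b <;> fin_cases c <;> fin_cases d <;>
    norm_num [termXY, bitSign, pauliX, pauliY]

theorem termAFHM_mat_apply (a b c d : Fin 2) :
    termAFHM.mat (a, b) (c, d)
      = (1 / 2) * (if a = c ∧ b = d then 1 else 0) - termQMC.mat (a, b) (c, d) := by
  rw [termQMC_mat_apply]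
  fin_cases a <;> fin_cases b <;> fin_cases c <;> fin_cases d <;>
    norm_num [termAFHM, pauliX, pauliY, pauliZ]

variable {V : Type*} [Fintype V] [DecidableEq V]

theorem one_apply_of_agree {i j : V} {x y : V → Fin 2} (h : ∀ k, k ≠ i → k ≠ j → x k = y k) :
    (1 : Matrix (V → Fin 2) (V → Fin 2) ℂ) x y = if x i = y i ∧ x j = y j then 1 else 0 := by
  rw [Matrix.one_apply]
  refine if_congr ⟨fun e => by simp [e], fun e => ?_⟩ rfl rfl
  funext k
  by_cases hi : k = i
  · exact hi ▸ e.1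
  by_cases hj : k = j
  · exact hj ▸ e.2
  exact h k hi hj

omit [DecidableEq V] in
theorem one_apply_of_not_agree {i j : V} {x y : V → Fin 2}
    (h : ¬ ∀ k, k ≠ i → k ≠ j → x k = y k) :
    (1 : Matrix (V → Fin 2) (V → Fin 2) ℂ) x y = 0 :=
  Matrix.one_apply_ne fun e => h fun k _ _ => congrFun e k

theorem pairOp_termQMC (i j : V) :
    pairOp termQMC i j = 1 - qubitPerm (Equiv.swap i j) := by
  ext x y
  have hs : qubitPerm (Equiv.swap i j) x y
      = (1 : Matrix (V → Fin 2) (V → Fin 2) ℂ) (x ∘ Equiv.swap i j) y := by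
    simp [qubitPerm_apply, Matrix.one_apply, Pi.single_apply, eq_comm]
  have hc : (∀ k, k ≠ i → k ≠ j → (x ∘ Equiv.swap i j) k = y k)
      ↔ ∀ k, k ≠ i → k ≠ j → x k = y k := by
    refine forall_congr' fun k => forall_congr' fun hi => forall_congr' fun hj => ?_
    rw [Function.comp_apply, Equiv.swap_apply_of_ne_of_ne hi hj]
  rw [Matrix.sub_apply, hs]
  simp only [pairOp, Matrix.of_apply]
  split_ifs with h
  · rw [termQMC_mat_apply, one_apply_of_agree h, one_apply_of_agree (hc.2 h)]
    simp
  · rw [one_apply_of_not_agree h, one_apply_of_not_agree (mt hc.1 h), sub_zero]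

theorem pairOp_termAFHM (i j : V) :
    pairOp termAFHM i j = (1 / 2 : ℝ) • 1 - pairOp termQMC i j := by
  ext x y
  simp only [Matrix.sub_apply, Matrix.smul_apply, pairOp, Matrix.of_apply]
  split_ifs with h
  · rw [termAFHM_mat_apply, one_apply_of_agree h, Complex.real_smul]
    norm_num
  · rw [one_apply_of_not_agree h, smul_zero, sub_zero]

/-- The sign `(-1) ^ (number of excited qubits on the color class 1)`. -/
def colorSign (c : V → Fin 2) (x : V → Fin 2) : ℂ :=
  ∏ k, if c k = 1 then bitSign (x k) else 1

omit [DecidableEq V] in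
theorem colorSign_mul_self (c x : V → Fin 2) : colorSign c x * colorSign c x = 1 := by
  rw [colorSign, ← Finset.prod_mul_distrib]
  refine Finset.prod_eq_one fun k _ => ?_
  split_ifs
  · exact bitSign_mul_self _
  · exact one_mul 1

-- This makes the global operator `colorZ` act on a single edge as `Z` on its endpoint of colour 1:
-- signs at all other vertices occur twice and cancel.
omit [DecidableEq V] in
theorem colorSign_mul_colorSign {c : V → Fin 2} {i j : V} (hi : c i = 0) (hj : c j = 1)
    {x y : V → Fin 2} (h : ∀ k, k ≠ i → k ≠ j → x k = y k) :
    colorSign c x * colorSign c y = bitSign (x j) * bitSign (y j) := by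
  rw [colorSign, colorSign, ← Finset.prod_mul_distrib, Finset.prod_eq_single j]
  · simp [hj]
  · intro k _ hk
    split_ifs with hc
    · rw [h k (fun e => by simp [e, hi] at hc) hk, bitSign_mul_self]
    · exact one_mul 1
  · simp

/-- The product of the operators `Z` on the color class 1. -/
def colorZ (c : V → Fin 2) : Matrix (V → Fin 2) (V → Fin 2) ℂ :=
  Matrix.diagonal (colorSign c)

theorem colorZ_mul_self (c : V → Fin 2) : colorZ c * colorZ c = 1 := by
  rw [colorZ, Matrix.diagonal_mul_diagonal, ← Matrix.diagonal_one]
  congr 1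
  funext x
  exact colorSign_mul_self c x

omit [DecidableEq V] in
theorem colorZ_conjTranspose (c : V → Fin 2) : (colorZ c).conjTranspose = colorZ c := by
  rw [colorZ, Matrix.diagonal_conjTranspose]
  congr 1
  funext x
  simp only [Pi.star_apply, colorSign, star_prod]
  refine Finset.prod_congr rfl fun k _ => ?_
  simp only [bitSign]
  split_ifs <;> simp

theorem pairOp_termXY {c : V → Fin 2} {i j : V} (hi : c i = 0) (hj : c j = 1) :
    pairOp termXY i j = (1 / 2 : ℝ) • pairOp termQMC i j
      + (1 / 2 : ℝ) • (colorZ c * (1 - pairOp termQMC i j) * colorZ c) := by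
  ext x y
  simp only [colorZ, Matrix.add_apply, Matrix.smul_apply, Matrix.mul_diagonal,
    Matrix.diagonal_mul, Matrix.sub_apply, Complex.real_smul]
  simp only [pairOp, Matrix.of_apply]
  split_ifs with h
  · rw [termXY_mat_apply, one_apply_of_agree h, ← colorSign_mul_colorSign hi hj h]
    push_cast
    ring
  · rw [one_apply_of_not_agree h]
    simp

theorem pairOp_termEPR {c : V → Fin 2} {i j : V} (hi : c i = 0) (hj : c j = 1) :
    pairOp termEPR i j
      = colorZ c * (pairOp termQMC i j).submatrix (· + c) (· + c) * colorZ c := by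
  ext x y
  simp only [colorZ, Matrix.mul_diagonal, Matrix.diagonal_mul, Matrix.submatrix_apply]
  simp only [pairOp, Matrix.of_apply, Pi.add_apply, add_left_inj, hi, hj, add_zero]
  split_ifs with h
  · rw [termEPR_mat_apply, ← colorSign_mul_colorSign hi hj h]
    ring
  · simp

end PauliTerms

/-! ### Weighted vertex covers and the bounds for bipartite graphs. -/

section Bipartite

open scoped ComplexOrder

variable {V : Type*} [Fintype V] [DecidableEq V] {G : SimpleGraph V} [DecidableRel G.Adj]

omit [Fintype V] [DecidableEq V] [DecidableRel G.Adj] in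
theorem exists_oriented_of_mem_edgeSet (c : G.Coloring (Fin 2)) {e : Sym2 V}
    (he : e ∈ G.edgeSet) : ∃ i j, e = s(i, j) ∧ G.Adj i j ∧ c i = 0 ∧ c j = 1 := by
  induction e using Sym2.ind with
  | _ i j =>
    have hadj : G.Adj i j := he
    have := c.valid hadj
    by_cases hi : c i = 0
    · exact ⟨i, j, rfl, hadj, hi, by omega⟩
    · exact ⟨j, i, Sym2.eq_swap, hadj.symm, by omega, by omega⟩

omit [DecidableEq V] in
theorem sum_edgeFinset_eq_sum_oriented {M : Type*} [AddCommMonoid M] (c : G.Coloring (Fin 2))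
    (F : Sym2 V → M) : ∑ e ∈ G.edgeFinset, F e
      = ∑ i, ∑ j, if G.Adj i j ∧ c i = 0 ∧ c j = 1 then F s(i, j) else 0 := by
  rw [← Finset.sum_product', Finset.univ_product_univ, ← Finset.sum_filter]
  symm
  refine Finset.sum_nbij (fun p => s(p.1, p.2)) ?_ ?_ ?_ fun _ _ => rfl
  · simp +contextual
  · rintro ⟨i, j⟩ h ⟨k, l⟩ h' e
    simp only [Finset.coe_filter, Finset.mem_univ, true_and, Set.mem_ofPred_eq] at h h'
    rcases Sym2.eq_iff.1 e with ⟨rfl, rfl⟩ | ⟨rfl, rfl⟩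
    · rfl
    · exact absurd (h.2.1.symm.trans h'.2.2) zero_ne_one
  · intro e he
    obtain ⟨i, j, rfl, h⟩ := exists_oriented_of_mem_edgeSet c (SimpleGraph.mem_edgeFinset.1 he)
    exact ⟨(i, j), by simpa using h, rfl⟩

/-- The weights of `w` on the edges from color class 0 to color class 1. -/
def orientedWeight (c : G.Coloring (Fin 2)) (w : Sym2 V → ℝ) (i j : V) : ℝ :=
  if G.Adj i j ∧ c i = 0 ∧ c j = 1 then w s(i, j) else 0

/-- The nonzero terms come from edges running from `i` of colour 0 to `σ i` of colour 1. The colours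
and the injectivity of `σ` prevent two of them from sharing a vertex, so they form a matching. -/
theorem sum_orientedWeight_perm_le (c : G.Coloring (Fin 2)) (w : Sym2 V → ℝ)
    (σ : Equiv.Perm V) : ∑ i, orientedWeight c w i (σ i) ≤ maxMatchingWeight G w := by
  set S : Finset V := Finset.univ.filter fun i => G.Adj i (σ i) ∧ c i = 0 ∧ c (σ i) = 1 with hS
  have hmem : ∀ {i}, i ∈ S ↔ G.Adj i (σ i) ∧ c i = 0 ∧ c (σ i) = 1 := by simp [hS]
  have hone : ∀ i ∈ S, ∀ j ∈ S, ∀ v, v ∈ s(i, σ i) → v ∈ s(j, σ j) → i = j := by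
    intro i hi j hj v h1 h2
    have hi' := (hmem.1 hi).2
    have hj' := (hmem.1 hj).2
    rcases Sym2.mem_iff.1 h1 with rfl | rfl <;> rcases Sym2.mem_iff.1 h2 with h | h
    · exact h
    · rw [h] at hi'; omega
    · rw [h] at hi'; omega
    · exact σ.injective h
  have hR : S.image (fun i => s(i, σ i)) ∈ matchings G := by
    rw [matchings, Finset.mem_filter, Finset.mem_powerset]
    constructor
    · intro e he
      obtain ⟨i, hi, rfl⟩ := Finset.mem_image.1 he
      exact SimpleGraph.mem_edgeFinset.2 (hmem.1 hi).1
    · intro v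
      rw [Finset.card_le_one]
      intro e he e' he'
      obtain ⟨h1, h2⟩ := Finset.mem_filter.1 he
      obtain ⟨h3, h4⟩ := Finset.mem_filter.1 he'
      obtain ⟨i, hi, rfl⟩ := Finset.mem_image.1 h1
      obtain ⟨j, hj, rfl⟩ := Finset.mem_image.1 h3
      rw [hone i hi j hj v h2 h4]
  have hsum : ∑ i, orientedWeight c w i (σ i) = ∑ e ∈ S.image (fun i => s(i, σ i)), w e := by
    rw [Finset.sum_image fun i hi j hj h =>
      hone i hi j hj i (Sym2.mem_mk_left _ _) ((congrArg (i ∈ ·) h).mp (Sym2.mem_mk_left _ _))]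
    simp only [orientedWeight, hS, Finset.sum_filter]
  rw [hsum]
  exact Finset.le_sup' (fun R => ∑ e ∈ R, w e) hR

/-- Egerváry's theorem: a nonnegative weighted vertex cover of weight at most that of a matching. -/
theorem exists_vertexCover_le_maxMatchingWeight (c : G.Coloring (Fin 2)) {w : Sym2 V → ℝ}
    (hw : ∀ e ∈ G.edgeSet, 0 < w e) : ∃ u v : V → ℝ, (∀ i, 0 ≤ u i) ∧ (∀ i, 0 ≤ v i) ∧
      (∀ i j, orientedWeight c w i j ≤ u i + v j) ∧
      ∑ i, u i + ∑ i, v i ≤ maxMatchingWeight G w := by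
  obtain ⟨u, v, σ, hu, hv, huv, hσ⟩ := exists_perm_sum_eq_dual (w := orientedWeight c w)
    fun i j => by
      unfold orientedWeight
      split_ifs with h
      · exact (hw _ h.1).le
      · exact le_rfl
  exact ⟨u, v, hu, hv, huv, hσ ▸ sum_orientedWeight_perm_le c w σ⟩

theorem edgeOp_mk (h : TwoQubitTerm) (i j : V) : edgeOp h s(i, j) = pairOp h i j := rfl

theorem hamiltonian_eq_real_smul (h : TwoQubitTerm) (w : Sym2 V → ℝ) :
    hamiltonian h G w = ∑ e ∈ G.edgeFinset, w e • edgeOp h e := by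
  simp only [hamiltonian, Complex.coe_smul]

theorem hamiltonian_termQMC_posSemidef {w : Sym2 V → ℝ} (hw : ∀ e ∈ G.edgeSet, 0 < w e) :
    (hamiltonian termQMC G w).PosSemidef := by
  rw [hamiltonian_eq_real_smul]
  refine Matrix.posSemidef_sum _ fun e he => ?_
  have he' := SimpleGraph.mem_edgeFinset.1 he
  refine Matrix.PosSemidef.smul ?_ (hw e he').le
  induction e using Sym2.ind with
  | _ i j =>
    rw [edgeOp_mk, pairOp_termQMC]
    exact one_sub_qubitPerm_swap_posSemidef i j

theorem totalWeight_sub_hamiltonian_termQMC (c : G.Coloring (Fin 2)) (w : Sym2 V → ℝ) :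
    totalWeight G w • 1 - hamiltonian termQMC G w
      = ∑ i, ∑ j, orientedWeight c w i j • qubitPerm (Equiv.swap i j) := by
  rw [hamiltonian_eq_real_smul, totalWeight, Finset.sum_smul, ← Finset.sum_sub_distrib,
    sum_edgeFinset_eq_sum_oriented c]
  refine Finset.sum_congr rfl fun i _ => Finset.sum_congr rfl fun j _ => ?_
  unfold orientedWeight
  split_ifs with h
  · rw [edgeOp_mk, pairOp_termQMC]
    module
  · rw [zero_smul]

theorem bound_sub_hamiltonian_termQMC_posSemidef (c : G.Coloring (Fin 2)) {w : Sym2 V → ℝ}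
    (hw : ∀ e ∈ G.edgeSet, 0 < w e) :
    ((totalWeight G w + maxMatchingWeight G w) • 1 - hamiltonian termQMC G w).PosSemidef := by
  obtain ⟨u, v, hu, hv, huv, hM⟩ := exists_vertexCover_le_maxMatchingWeight c hw
  set p := orientedWeight c w with hp
  have hp0 : ∀ i j, 0 ≤ p i j := fun i j => by
    rw [hp]
    unfold orientedWeight
    split_ifs with h
    · exact (hw _ h.1).le
    · exact le_rfl
  have hpd : ∀ i, p i i = 0 := fun i => by simp [hp, orientedWeight]
  -- The first sum has stars at the `u` side with weights capped by `u i`, the second has stars at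
  -- the `v` side with the excess, and the last term is the slack in the cover bound.
  have key : (totalWeight G w + maxMatchingWeight G w) • 1 - hamiltonian termQMC G w
      = ∑ i, (u i • 1 + ∑ j, min (p i j) (u i) • qubitPerm (Equiv.swap i j))
        + ∑ j, (v j • 1 + ∑ i, (p i j - min (p i j) (u i)) • qubitPerm (Equiv.swap j i))
        + (maxMatchingWeight G w - (∑ i, u i + ∑ i, v i)) • 1 := by
    have h1 : ∑ j, ∑ i, (p i j - min (p i j) (u i)) • qubitPerm (Equiv.swap j i)
        = ∑ i, ∑ j, p i j • qubitPerm (Equiv.swap i j)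
          - ∑ i, ∑ j, min (p i j) (u i) • qubitPerm (Equiv.swap i j) := by
      rw [Finset.sum_comm]
      simp only [sub_smul, Finset.sum_sub_distrib, Equiv.swap_comm]
    rw [add_smul, add_sub_right_comm, totalWeight_sub_hamiltonian_termQMC c w,
      Finset.sum_add_distrib, Finset.sum_add_distrib, h1, ← Finset.sum_smul, ← Finset.sum_smul]
    module
  rw [key]
  refine Matrix.PosSemidef.add (Matrix.PosSemidef.add ?_ ?_)
    (Matrix.PosSemidef.one.smul (sub_nonneg.2 hM))
  · exact Matrix.posSemidef_sum _ fun i _ => star_posSemidef _ _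
      (fun j => le_min (hp0 i j) (hu i)) (fun j => min_le_right _ _) (by simp [hpd, hu])
  · refine Matrix.posSemidef_sum _ fun j _ => star_posSemidef _ _
      (fun i => sub_nonneg.2 (min_le_left _ _)) (fun i => ?_) (by simp [hpd, hu])
    have := huv i j
    have := hv j
    -- The excess is either `0` or `p i j - u i`, both at most `v j`.
    rcases min_choice (p i j) (u i) with h | h <;> rw [h] <;> linarith

/-! ### Transfer to the EPR, XY and Heisenberg Hamiltonians. -/

theorem hamiltonian_termEPR (c : G.Coloring (Fin 2)) (w : Sym2 V → ℝ) :
    hamiltonian termEPR G w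
      = colorZ c * (hamiltonian termQMC G w).submatrix (· + ⇑c) (· + ⇑c) * colorZ c := by
  have h : ∀ e ∈ G.edgeFinset, w e • edgeOp termEPR e
      = colorZ c * (w e • (edgeOp termQMC e).submatrix (· + ⇑c) (· + ⇑c)) * colorZ c := by
    intro e he
    obtain ⟨i, j, rfl, -, hi, hj⟩ :=
      exists_oriented_of_mem_edgeSet c (SimpleGraph.mem_edgeFinset.1 he)
    rw [edgeOp_mk, edgeOp_mk, pairOp_termEPR hi hj, mul_smul_comm, smul_mul_assoc]
  rw [hamiltonian_eq_real_smul, hamiltonian_eq_real_smul, Finset.sum_congr rfl h,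
    ← Finset.sum_mul, ← Finset.mul_sum]
  congr 2
  ext x y
  simp [Matrix.sum_apply]

theorem hamiltonian_termXY (c : G.Coloring (Fin 2)) (w : Sym2 V → ℝ) :
    hamiltonian termXY G w = (1 / 2 : ℝ) • hamiltonian termQMC G w
      + (1 / 2 : ℝ) • (colorZ c * (totalWeight G w • 1 - hamiltonian termQMC G w) * colorZ c) := by
  have h : ∀ e ∈ G.edgeFinset, w e • edgeOp termXY e = (1 / 2 : ℝ) • (w e • edgeOp termQMC e)
      + (1 / 2 : ℝ) • (colorZ c * (w e • 1 - w e • edgeOp termQMC e) * colorZ c) := by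
    intro e he
    obtain ⟨i, j, rfl, -, hi, hj⟩ :=
      exists_oriented_of_mem_edgeSet c (SimpleGraph.mem_edgeFinset.1 he)
    rw [edgeOp_mk, edgeOp_mk, pairOp_termXY hi hj, ← smul_sub, mul_smul_comm, smul_mul_assoc]
    module
  rw [hamiltonian_eq_real_smul, hamiltonian_eq_real_smul, Finset.sum_congr rfl h,
    Finset.sum_add_distrib, ← Finset.smul_sum, ← Finset.smul_sum, ← Finset.sum_mul,
    ← Finset.mul_sum, Finset.sum_sub_distrib, ← Finset.sum_smul, totalWeight]

theorem hamiltonian_termAFHM (w : Sym2 V → ℝ) :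
    hamiltonian termAFHM G w = (totalWeight G w / 2) • 1 - hamiltonian termQMC G w := by
  rw [hamiltonian_eq_real_smul, hamiltonian_eq_real_smul, totalWeight, Finset.sum_div,
    Finset.sum_smul, ← Finset.sum_sub_distrib]
  refine Finset.sum_congr rfl fun e _ => ?_
  induction e using Sym2.ind with
  | _ i j =>
    rw [edgeOp_mk, edgeOp_mk, pairOp_termAFHM]
    module

theorem Matrix.PosSemidef.colorZ_mul_mul_colorZ {A : Matrix (V → Fin 2) (V → Fin 2) ℂ}
    (hA : A.PosSemidef) (c : V → Fin 2) : (colorZ c * A * colorZ c).PosSemidef := by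
  simpa only [colorZ_conjTranspose] using hA.mul_mul_conjTranspose_same (colorZ c)

theorem colorZ_mul_smul_one_mul_colorZ (c : V → Fin 2) (r : ℝ) :
    colorZ c * (r • 1) * colorZ c = r • 1 := by
  rw [mul_smul_comm, mul_one, smul_mul_assoc, colorZ_mul_self]

theorem bound_sub_hamiltonian_termEPR_posSemidef (c : G.Coloring (Fin 2)) {w : Sym2 V → ℝ}
    (hw : ∀ e ∈ G.edgeSet, 0 < w e) :
    ((totalWeight G w + maxMatchingWeight G w) • 1 - hamiltonian termEPR G w).PosSemidef := by
  convert ((bound_sub_hamiltonian_termQMC_posSemidef c hw).submatrix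
    (· + ⇑c)).colorZ_mul_mul_colorZ c using 1
  have h1 : ∀ r : ℝ, (r • (1 : Matrix (V → Fin 2) (V → Fin 2) ℂ)).submatrix
      (· + ⇑c) (· + ⇑c) = r • 1 := fun r => by
    rw [Matrix.submatrix_smul, Pi.smul_apply, Pi.smul_apply,
      Matrix.submatrix_one _ (add_left_injective _)]
  rw [hamiltonian_termEPR c w, Matrix.submatrix_sub, Pi.sub_apply, Pi.sub_apply, h1, mul_sub,
    sub_mul, colorZ_mul_smul_one_mul_colorZ]

theorem bound_sub_hamiltonian_termXY_posSemidef (c : G.Coloring (Fin 2)) {w : Sym2 V → ℝ}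
    (hw : ∀ e ∈ G.edgeSet, 0 < w e) :
    ((totalWeight G w + maxMatchingWeight G w / 2) • 1 - hamiltonian termXY G w).PosSemidef := by
  convert ((bound_sub_hamiltonian_termQMC_posSemidef c hw).smul
      (show (0 : ℝ) ≤ 1 / 2 by norm_num)).add
    (((hamiltonian_termQMC_posSemidef hw).colorZ_mul_mul_colorZ c).smul
      (show (0 : ℝ) ≤ 1 / 2 by norm_num)) using 1
  rw [hamiltonian_termXY c w, mul_sub, sub_mul, colorZ_mul_smul_one_mul_colorZ]
  module

theorem hamiltonian_termXY_add_bound_posSemidef (c : G.Coloring (Fin 2)) {w : Sym2 V → ℝ}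
    (hw : ∀ e ∈ G.edgeSet, 0 < w e) :
    (hamiltonian termXY G w + (maxMatchingWeight G w / 2) • 1).PosSemidef := by
  convert ((hamiltonian_termQMC_posSemidef hw).smul (show (0 : ℝ) ≤ 1 / 2 by norm_num)).add
    (((bound_sub_hamiltonian_termQMC_posSemidef c hw).colorZ_mul_mul_colorZ c).smul
      (show (0 : ℝ) ≤ 1 / 2 by norm_num)) using 1
  rw [hamiltonian_termXY c w, mul_sub, mul_sub, sub_mul, sub_mul,
    colorZ_mul_smul_one_mul_colorZ, colorZ_mul_smul_one_mul_colorZ]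
  module

end Bipartite

theorem mainTheorem3 {V : Type*} [Fintype V] [DecidableEq V]
    (G : SimpleGraph V) [DecidableRel G.Adj] (hG : G.IsBipartite)
    (w : Sym2 V → ℝ) (hw : ∀ e ∈ G.edgeSet, 0 < w e) :
    lambdaMax (hamiltonian termQMC G w) (hamiltonian_isHermitian termQMC G w)
        ≤ totalWeight G w + maxMatchingWeight G w ∧
      lambdaMax (hamiltonian termEPR G w) (hamiltonian_isHermitian termEPR G w)
        ≤ totalWeight G w + maxMatchingWeight G w ∧
      lambdaMax (hamiltonian termXY G w) (hamiltonian_isHermitian termXY G w)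
        ≤ totalWeight G w + maxMatchingWeight G w / 2 ∧
      -(maxMatchingWeight G w / 2)
        ≤ lambdaMin (hamiltonian termXY G w) (hamiltonian_isHermitian termXY G w) ∧
      -(totalWeight G w / 2) - maxMatchingWeight G w
        ≤ lambdaMin (hamiltonian termAFHM G w) (hamiltonian_isHermitian termAFHM G w) := by
  obtain ⟨c⟩ := hG
  have hQ := bound_sub_hamiltonian_termQMC_posSemidef c hw
  refine ⟨lambdaMax_le _ hQ, lambdaMax_le _ ?_, lambdaMax_le _ ?_, le_lambdaMin _ ?_,
    le_lambdaMin _ ?_⟩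
  · exact bound_sub_hamiltonian_termEPR_posSemidef c hw
  · exact bound_sub_hamiltonian_termXY_posSemidef c hw
  · rw [neg_smul, sub_neg_eq_add]
    exact hamiltonian_termXY_add_bound_posSemidef c hw
  · convert hQ using 1
    rw [hamiltonian_termAFHM]
    module
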